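/- Let $\nu\in\mathbb{R}^d$ be a unit vector, let $H$ be a hyperplane of $\mathbb{R}^d$ with unit normal $\nu$, and let $H_-=\{z+t\nu : z\in H,\ t\le 0\}$. For a Lebesgue measurable set $\Omega\subseteq\mathbb{R}^d$ let $\partial^*\Omega$ be its essential boundary, that is, the set of points at which both $\Omega$ and its complement have strictly positive upper $d$-dimensional density. Call $\Omega$ essentially open if it agrees with an open set up to a Lebesgue-null set, and Steiner symmetric about $H$ if, up to a Lebesgue-null set, $$\Omega=\Big\{z+t\nu : z\in H,\ |t|<\tfrac12\mathcal{H}^1\big(\Omega\cap\{z+s\nu : s\in\mathbb{R}\}\big)\Big\}.$$ Let $\omega\subseteq H_-$ be a bounded Lebesgue measurable set such that for every $z\in H$ the set $\overline{\partial^*\omega}\cap\{z+t\nu : t<0\}$ is empty or a singleton. Define $g:H\to(-\infty,0]$ by $g(z)=0$ if this set is empty, and $g(z)=t$ if it is $\{z+t\nu\}$. Then, up to a Lebesgue-null set, $\omega$ is the subgraph $\{z+t\nu : z\in H,\ g(z)<t<0\}$ of $g$, and moreover: (i) $|\overline{\partial^*\omega}|=0$; (ii) $\omega$ is essentially open; (iii)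 the union of $\omega$ and its reflection about $H$ is Steiner symmetric about $H$; (iv) $g$ is continuous on $H$. -/

import Mathlib

open MeasureTheory Set Filter Topology
open scoped ENNReal

noncomputable section

/-- The upper `d`-dimensional density of `Ω` at `x`:
the limsup as `r → 0⁺` of `|Ω ∩ B_r(x)| / |B_r(x)|`. -/
def upperDensity {d : ℕ} (Ω : Set (EuclideanSpace ℝ (Fin d)))
    (x : EuclideanSpace ℝ (Fin d)) : ℝ≥0∞ :=
  limsup (fun r : ℝ => volume (Ω ∩ Metric.ball x r) / volume (Metric.ball x r)) (𝓝[>] 0)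

/-- The essential boundary `∂*Ω`: the points at which both `Ω` and its complement have
strictly positive upper density. -/
def essBoundary {d : ℕ} (Ω : Set (EuclideanSpace ℝ (Fin d))) :
    Set (EuclideanSpace ℝ (Fin d)) :=
  {x | 0 < upperDensity Ω x ∧ 0 < upperDensity Ωᶜ x}

/-- `Ω` is essentially open: it agrees with an open set up to a Lebesgue-null set. -/
def EssentiallyOpen {d : ℕ} (Ω : Set (EuclideanSpace ℝ (Fin d))) : Prop :=
  ∃ U : Set (EuclideanSpace ℝ (Fin d)), IsOpen U ∧ Ω =ᵐ[volume] U

/-- The hyperplane `{x : ⟨ν, x⟩ = c}`. For `‖ν‖ = 1` and varying `c` these are exactly the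
hyperplanes with unit normal `ν`. -/
def hyperplane {d : ℕ} (ν : EuclideanSpace ℝ (Fin d)) (c : ℝ) :
    Set (EuclideanSpace ℝ (Fin d)) :=
  {x | inner ℝ ν x = c}

/-- The closed halfspace `H_- = {z + t ν : z ∈ H, t ≤ 0}` below `H = hyperplane ν c`. -/
def lowerHalfspace {d : ℕ} (ν : EuclideanSpace ℝ (Fin d)) (c : ℝ) :
    Set (EuclideanSpace ℝ (Fin d)) :=
  {x | ∃ z ∈ hyperplane ν c, ∃ t : ℝ, t ≤ 0 ∧ x = z + t • ν}

/-- The reflection about `hyperplane ν c` (for a unit vector `ν`). -/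
def reflectAbout {d : ℕ} (ν : EuclideanSpace ℝ (Fin d)) (c : ℝ)
    (x : EuclideanSpace ℝ (Fin d)) : EuclideanSpace ℝ (Fin d) :=
  x - (2 * (inner ℝ ν x - c)) • ν

/-- The line `{z + t ν : t ∈ ℝ}`. -/
def normalLine {d : ℕ} (ν z : EuclideanSpace ℝ (Fin d)) : Set (EuclideanSpace ℝ (Fin d)) :=
  {x | ∃ t : ℝ, x = z + t • ν}

/-- The open half-line `{z + t ν : t < 0}`. -/
def lowerRay {d : ℕ} (ν z : EuclideanSpace ℝ (Fin d)) : Set (EuclideanSpace ℝ (Fin d)) :=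
  {x | ∃ t : ℝ, t < 0 ∧ x = z + t • ν}

/-- `Ω` is Steiner symmetric about `H = hyperplane ν c`: up to a Lebesgue-null set it equals
`{z + t ν : z ∈ H, |t| < ½ ℋ¹(Ω ∩ {z + s ν : s ∈ ℝ})}`. -/
def SteinerSymmetric {d : ℕ} (ν : EuclideanSpace ℝ (Fin d)) (c : ℝ)
    (Ω : Set (EuclideanSpace ℝ (Fin d))) : Prop :=
  Ω =ᵐ[volume] ({x | ∃ z ∈ hyperplane ν c, ∃ t : ℝ, x = z + t • ν ∧
    ENNReal.ofReal |t| < Measure.hausdorffMeasure 1 (Ω ∩ normalLine ν z) / 2} :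
      Set (EuclideanSpace ℝ (Fin d)))

open Classical in
/-- The function `g : H → ℝ` associated with `ω`: `g z = t` if `z + t ν` is the point of the
closure of `∂*ω` on the open half-line below `z`, and `g z = 0` if there is no such point. -/
def boundaryHeight {d : ℕ} (ν : EuclideanSpace ℝ (Fin d)) (c : ℝ)
    (ω : Set (EuclideanSpace ℝ (Fin d))) (z : hyperplane ν c) : ℝ :=
  if h : ∃ t : ℝ, t < 0 ∧ (z : EuclideanSpace ℝ (Fin d)) + t • ν ∈ closure (essBoundary ω)
  then h.choose else 0

/-- When the half-line below `z` meets the closure of `∂*ω` in at most one point, that point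
determines `boundaryHeight`. -/
theorem boundaryHeight_eq {d : ℕ} {ν : EuclideanSpace ℝ (Fin d)} (hν : ‖ν‖ = 1) {c : ℝ}
    {ω : Set (EuclideanSpace ℝ (Fin d))} {z : hyperplane ν c}
    (hz : (closure (essBoundary ω) ∩ lowerRay ν z).Subsingleton) {t : ℝ} (ht : t < 0)
    (hmem : (z : EuclideanSpace ℝ (Fin d)) + t • ν ∈ closure (essBoundary ω)) :
    boundaryHeight ν c ω z = t := by
  have h : ∃ t : ℝ, t < 0 ∧
      (z : EuclideanSpace ℝ (Fin d)) + t • ν ∈ closure (essBoundary ω) := ⟨t, ht, hmem⟩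
  have hν0 : ν ≠ 0 := by
    rintro rfl
    simp at hν
  rw [boundaryHeight, dif_pos h]
  have key := hz ⟨h.choose_spec.2, _, h.choose_spec.1, rfl⟩ ⟨hmem, t, ht, rfl⟩
  exact smul_left_injective ℝ hν0 (add_left_cancel key)

end

/-!
Let `K` be the closure of the essential boundary of `ω`. Two facts carry the proof.

Off `K`, the set `ω` is locally null or locally conull (`compl_closure_essBoundary_subset`). Indeed,
if a ball met both `ω` and its complement in positive measure, then, moving a small ball
from a density point of one to a density point of the other, one finds inside it a smaller ball
exactly half filled by `ω`. Iterating, the half-filled balls shrink to a point at which both `ω` and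
its complement have positive upper density, that is, to a point of the essential boundary. The open
sets of exterior and of interior points are disjoint, so a connected set that avoids `K` lies in
one of them.

On the half-line below `z` this leaves only the height `g z` at which a transition may take place.
Below it the points are exterior since `ω` is bounded
(`mem_essExterior_of_lt_boundaryHeight`). Between `g z` and `0` they are interior
(`mem_essExterior_compl_of_boundaryHeight_lt`): were they exterior, all lines near that of `z`
would be exterior on both sides of the height `g z`, hence, each of them meeting `K` at most once,
at all their points off `K`; as `K` is null below the hyperplane, `ω` would be null near a point
of `K`.

Continuity of `g` follows because exterior and interior are open. A measurable set meeting each line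
in direction `ν` at most once is null, having infinitely many disjoint translates in a bounded
region; with the hyperplane being null this gives `|K| = 0`, and `ω` agrees almost everywhere with
the subgraph of `g`, which is open. Steiner symmetry then follows from Fubini along the lines in
direction `ν` (`steinerSymmetric_of_ae_eq`).
-/

/-! ### Local structure of a set away from its essential boundary -/

/-- The measure-theoretic exterior of `Ω`: the points having a ball that meets `Ω` in a null set.
The exterior of the complement, `essExterior Ωᶜ`, is the measure-theoretic interior of `Ω`. -/
def essExterior {d : ℕ} (Ω : Set (EuclideanSpace ℝ (Fin d))) : Set (EuclideanSpace ℝ (Fin d)) :=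
  {x | ∃ r : ℝ, 0 < r ∧ volume (Ω ∩ Metric.ball x r) = 0}

section LocalStructure

variable {d : ℕ} {Ω : Set (EuclideanSpace ℝ (Fin d))}

theorem mem_essExterior_of_isOpen {U : Set (EuclideanSpace ℝ (Fin d))} (hU : IsOpen U)
    (h : volume (Ω ∩ U) = 0) {x : EuclideanSpace ℝ (Fin d)} (hx : x ∈ U) :
    x ∈ essExterior Ω := by
  obtain ⟨r, hr, hrU⟩ := Metric.isOpen_iff.1 hU x hx
  exact ⟨r, hr, measure_mono_null (inter_subset_inter_right _ hrU) h⟩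

theorem isOpen_essExterior (Ω : Set (EuclideanSpace ℝ (Fin d))) : IsOpen (essExterior Ω) := by
  rw [isOpen_iff_mem_nhds]
  rintro x ⟨r, hr, h⟩
  filter_upwards [Metric.ball_mem_nhds x hr] with y hy
  exact mem_essExterior_of_isOpen Metric.isOpen_ball h hy

theorem measure_inter_essExterior (Ω : Set (EuclideanSpace ℝ (Fin d))) :
    volume (Ω ∩ essExterior Ω) = 0 := by
  refine measure_null_of_locally_null _ ?_
  rintro x ⟨hx, r, hr, h⟩
  refine ⟨Ω ∩ Metric.ball x r, ?_, h⟩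
  filter_upwards [self_mem_nhdsWithin, mem_nhdsWithin_of_mem_nhds (Metric.ball_mem_nhds x hr)]
    with y hy hy'
  exact ⟨hy.1, hy'⟩

theorem disjoint_essExterior_compl (Ω : Set (EuclideanSpace ℝ (Fin d))) :
    Disjoint (essExterior Ω) (essExterior Ωᶜ) := by
  rw [Set.disjoint_left]
  rintro x ⟨r, hr, h⟩ ⟨s, hs, h'⟩
  have h0 : volume (Metric.ball x (min r s)) = 0 := by
    refine measure_mono_null (t := (Ω ∩ Metric.ball x r) ∪ (Ωᶜ ∩ Metric.ball x s)) ?_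
      (measure_union_null h h')
    intro y hy
    by_cases hyΩ : y ∈ Ω
    · exact Or.inl ⟨hyΩ, Metric.ball_subset_ball (min_le_left _ _) hy⟩
    · exact Or.inr ⟨hyΩ, Metric.ball_subset_ball (min_le_right _ _) hy⟩
  exact (Metric.measure_ball_pos volume x (lt_min hr hs)).ne' h0

theorem upperDensity_eq_zero_of_mem_essExterior {x : EuclideanSpace ℝ (Fin d)}
    (hx : x ∈ essExterior Ω) : upperDensity Ω x = 0 := by
  obtain ⟨r, hr, h⟩ := hx
  have : (fun s : ℝ => volume (Ω ∩ Metric.ball x s) / volume (Metric.ball x s))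
      =ᶠ[𝓝[>] 0] fun _ => 0 := by
    filter_upwards [mem_nhdsWithin_of_mem_nhds (Iio_mem_nhds hr)] with s hs
    rw [measure_mono_null (inter_subset_inter_right _ (Metric.ball_subset_ball (le_of_lt hs))) h,
      ENNReal.zero_div]
  rw [upperDensity, limsup_congr this, limsup_const]

theorem disjoint_essExterior_closure_essBoundary (Ω : Set (EuclideanSpace ℝ (Fin d))) :
    Disjoint (essExterior Ω) (closure (essBoundary Ω)) := by
  refine Disjoint.closure_right ?_ (isOpen_essExterior Ω)
  rw [Set.disjoint_left]
  intro x hx hx'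
  exact hx'.1.ne' (upperDensity_eq_zero_of_mem_essExterior hx)

/-- It suffices that arbitrarily small balls close to `x`, not necessarily centred at `x`, are
filled by `Ω` to at least one half: the ball about `x` of twice the radius contains such a ball. -/
theorem upperDensity_pos {x : EuclideanSpace ℝ (Fin d)}
    (h : ∀ ε > 0, ∃ r, 0 < r ∧ r < ε ∧ ∃ y, dist x y ≤ r ∧
      volume (Metric.ball y r) / 2 ≤ volume (Ω ∩ Metric.ball y r)) :
    0 < upperDensity Ω x := by
  set a : ℝ≥0∞ :=
    ENNReal.ofReal (2 ^ Module.finrank ℝ (EuclideanSpace ℝ (Fin d))) with ha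
  have ha0 : a ≠ 0 := by simp [ha]
  have hat : a ≠ ∞ := ENNReal.ofReal_ne_top
  have hpos : 0 < (2 * a)⁻¹ := by
    rw [ENNReal.inv_pos]
    exact ENNReal.mul_ne_top (by simp) hat
  refine hpos.trans_le (le_limsup_of_frequently_le' ?_)
  rw [Filter.frequently_iff]
  intro V hV
  obtain ⟨ε, hε, hεV⟩ := mem_nhdsGT_iff_exists_Ioo_subset.1 hV
  obtain ⟨r, hr, hrε, y, hxy, hy⟩ := h (ε / 2) (half_pos hε)
  refine ⟨2 * r, hεV ⟨by linarith, by linarith⟩, ?_⟩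
  have hvol : volume (Metric.ball x (2 * r)) = a * volume (Metric.ball y r) := by
    rw [Measure.addHaar_ball_mul_of_pos volume x two_pos r, Measure.addHaar_ball_center volume y r]
  have hsub : Metric.ball y r ⊆ Metric.ball x (2 * r) :=
    Metric.ball_subset_ball' (by rw [dist_comm]; linarith)
  rw [ENNReal.le_div_iff_mul_le (Or.inl (Metric.measure_ball_pos volume x (by linarith)).ne')
    (Or.inl measure_ball_lt_top.ne), hvol]
  calc (2 * a)⁻¹ * (a * volume (Metric.ball y r))
      = (a⁻¹ * a) * (volume (Metric.ball y r) / 2) := by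
        rw [ENNReal.mul_inv (Or.inl two_ne_zero) (Or.inl (by simp)), div_eq_mul_inv]
        ring
    _ = volume (Metric.ball y r) / 2 := by rw [ENNReal.inv_mul_cancel ha0 hat, one_mul]
    _ ≤ volume (Ω ∩ Metric.ball y r) := hy
    _ ≤ volume (Ω ∩ Metric.ball x (2 * r)) := measure_mono (inter_subset_inter_right _ hsub)

theorem continuous_measureReal_inter_ball (Ω : Set (EuclideanSpace ℝ (Fin d))) {r : ℝ}
    (hr : 0 < r) : Continuous fun x => volume.real (Ω ∩ Metric.ball x r) := by
  have key : Continuous fun x : EuclideanSpace ℝ (Fin d) =>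
      ∫ a, (Metric.ball x r).indicator (fun _ => (1 : ℝ)) a ∂(volume.restrict Ω) := by
    rw [continuous_iff_continuousAt]
    intro x₀
    refine continuousAt_of_dominated
      (bound := (Metric.ball x₀ (r + 1)).indicator fun _ => (1 : ℝ)) ?_ ?_ ?_ ?_
    · exact Eventually.of_forall fun x =>
        (measurable_const.indicator measurableSet_ball).aestronglyMeasurable
    · filter_upwards [Metric.ball_mem_nhds x₀ one_pos] with x hx
      refine Eventually.of_forall fun a => ?_
      rw [norm_indicator_eq_indicator_norm]
      simp only [norm_one]
      refine indicator_le_indicator_of_subset (Metric.ball_subset_ball' ?_)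
        (fun _ => zero_le_one) a
      have := Metric.mem_ball.1 hx
      linarith
    · rw [integrable_indicator_iff measurableSet_ball]
      refine integrableOn_const ?_
      exact ((Measure.restrict_apply_le _ _).trans_lt measure_ball_lt_top).ne
    · have h0 : ∀ᵐ a ∂(volume.restrict Ω), a ∉ Metric.sphere x₀ r :=
        ae_restrict_of_ae (measure_eq_zero_iff_ae_notMem.1
          (Measure.addHaar_sphere_of_ne_zero volume x₀ hr.ne'))
      filter_upwards [h0] with a ha
      rcases lt_or_gt_of_ne (show dist a x₀ ≠ r from ha) with h | h
      · refine (continuousAt_const (y := (1 : ℝ))).congr ?_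
        have hc : ContinuousAt (fun x => dist a x) x₀ := by fun_prop
        filter_upwards [hc.eventually (gt_mem_nhds h)] with x hx
        exact (indicator_of_mem (Metric.mem_ball.2 hx) fun _ => (1 : ℝ)).symm
      · refine (continuousAt_const (y := (0 : ℝ))).congr ?_
        have hc : ContinuousAt (fun x => dist a x) x₀ := by fun_prop
        filter_upwards [hc.eventually (lt_mem_nhds h)] with x hx
        exact (indicator_of_notMem (fun h' => lt_asymm hx (Metric.mem_ball.1 h')) _).symm
  refine key.congr fun x => ?_
  rw [integral_indicator_const _ measurableSet_ball, smul_eq_mul, mul_one,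
    measureReal_restrict_apply measurableSet_ball, inter_comm]

theorem exists_mem_eventually_half_lt (hΩ : NullMeasurableSet Ω volume)
    {U : Set (EuclideanSpace ℝ (Fin d))} (hU : IsOpen U) (h : volume (Ω ∩ U) ≠ 0) :
    ∃ x ∈ U, ∀ᶠ r in 𝓝[>] (0 : ℝ),
      volume.real (Metric.ball x r) / 2 < volume.real (Ω ∩ Metric.ball x r) := by
  have hne : (ae (volume.restrict (Ω ∩ U))).NeBot := by
    rw [ae_neBot, Ne, Measure.restrict_eq_zero]
    exact h
  obtain ⟨x, hx, hxU⟩ := ((Besicovitch.ae_tendsto_measure_inter_div volume (Ω ∩ U)).and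
    (ae_restrict_mem₀ (hΩ.inter hU.nullMeasurableSet))).exists
  refine ⟨x, hxU.2, ?_⟩
  have hhalf : (2⁻¹ : ℝ≥0∞) < 1 := by simp
  filter_upwards [hx.eventually (lt_mem_nhds hhalf), self_mem_nhdsWithin] with r hr hr0
  have hr0 : 0 < r := hr0
  -- The differentiation theorem is about closed balls; spheres are null.
  have hcb : (Metric.closedBall x r : Set _) =ᵐ[volume] Metric.ball x r := by
    rw [← Metric.ball_union_sphere]
    exact union_ae_eq_left_of_ae_eq_empty
      (ae_eq_empty.2 (Measure.addHaar_sphere_of_ne_zero volume x hr0.ne'))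
  have hcb' : (Ω ∩ U ∩ Metric.closedBall x r : Set _) =ᵐ[volume]
      (Ω ∩ U ∩ Metric.ball x r : Set _) := ae_eq_set_inter (ae_eq_refl _) hcb
  rw [measure_congr hcb, measure_congr hcb',
    ENNReal.lt_div_iff_mul_lt (Or.inl (Metric.measure_ball_pos volume x hr0).ne')
      (Or.inl measure_ball_lt_top.ne)] at hr
  have hr' : 2⁻¹ * volume (Metric.ball x r) < volume (Ω ∩ Metric.ball x r) :=
    hr.trans_le (measure_mono (inter_subset_inter_left _ inter_subset_left))
  have hfin : volume (Ω ∩ Metric.ball x r) ≠ ∞ :=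
    (measure_mono inter_subset_right |>.trans_lt measure_ball_lt_top).ne
  have := (ENNReal.toReal_lt_toReal hr'.ne_top hfin).2 hr'
  rw [ENNReal.toReal_mul, ENNReal.toReal_inv, ENNReal.toReal_ofNat] at this
  simp only [measureReal_def]
  linarith

theorem measureReal_inter_ball_add_compl (hΩ : NullMeasurableSet Ω volume)
    (x : EuclideanSpace ℝ (Fin d)) (r : ℝ) :
    volume.real (Ω ∩ Metric.ball x r) + volume.real (Ωᶜ ∩ Metric.ball x r)
      = volume.real (Metric.ball x r) := by
  have h := measure_inter_add_sdiff₀ (μ := volume) (Metric.ball x r) hΩ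
  simp only [measureReal_def]
  rw [← ENNReal.toReal_add, inter_comm, inter_comm Ωᶜ, ← sdiff_eq, h]
  · exact (measure_mono inter_subset_right |>.trans_lt measure_ball_lt_top).ne
  · exact (measure_mono inter_subset_right |>.trans_lt measure_ball_lt_top).ne

/-- If a ball meets both `Ω` and its complement in positive measure, it contains density points of
both; a small ball moving from one to the other is, at some moment, exactly half filled. -/
theorem exists_half_filled_ball (hΩ : NullMeasurableSet Ω volume)
    {x : EuclideanSpace ℝ (Fin d)} {R : ℝ} (h : volume (Ω ∩ Metric.ball x R) ≠ 0)
    (h' : volume (Ωᶜ ∩ Metric.ball x R) ≠ 0) {δ : ℝ} (hδ : 0 < δ) :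
    ∃ y r, 0 < r ∧ r ≤ δ ∧ Metric.closedBall y r ⊆ Metric.ball x R ∧
      volume.real (Ω ∩ Metric.ball y r) = volume.real (Metric.ball y r) / 2 := by
  obtain ⟨p, hp, hp'⟩ := exists_mem_eventually_half_lt hΩ Metric.isOpen_ball h
  obtain ⟨q, hq, hq'⟩ := exists_mem_eventually_half_lt hΩ.compl Metric.isOpen_ball h'
  set M := max (dist p x) (dist q x)
  have hM : M < R := max_lt hp hq
  have hsmall : ∀ᶠ r in 𝓝[>] (0 : ℝ), r < min δ (R - M) :=
    mem_nhdsWithin_of_mem_nhds (Iio_mem_nhds (lt_min hδ (sub_pos.2 hM)))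
  obtain ⟨r, hpr, hqr, hr, hr0⟩ :=
    (hp'.and (hq'.and (hsmall.and self_mem_nhdsWithin))).exists
  have hr0 : 0 < r := hr0
  have hcenter : ∀ y : EuclideanSpace ℝ (Fin d), volume.real (Metric.ball y r)
      = volume.real (Metric.ball (0 : EuclideanSpace ℝ (Fin d)) r) := fun y => by
    simp only [measureReal_def, Measure.addHaar_ball_center]
  have hqr' := measureReal_inter_ball_add_compl hΩ q r
  rw [hcenter] at hpr hqr hqr'
  have hconn : IsPreconnected (Metric.closedBall x M) :=
    (convex_closedBall x M).isPreconnected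
  obtain ⟨y, hy, hyr⟩ := hconn.intermediate_value (a := q) (b := p)
    (Metric.mem_closedBall.2 (le_max_right _ _)) (Metric.mem_closedBall.2 (le_max_left _ _))
    (continuous_measureReal_inter_ball Ω hr0).continuousOn
    (show volume.real (Metric.ball (0 : EuclideanSpace ℝ (Fin d)) r) / 2 ∈ _ from
      ⟨by linarith, by linarith⟩)
  have hrM := hr.trans_le (min_le_right _ _)
  refine ⟨y, r, hr0, hr.le.trans (min_le_left _ _), ?_, hyr.trans (by rw [hcenter y])⟩
  refine Metric.closedBall_subset_ball' ?_
  have := Metric.mem_closedBall.1 hy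
  linarith

/-- Iterating `exists_half_filled_ball` gives a decreasing sequence of half-filled balls; its
common point sees positive upper density of both `Ω` and its complement. -/
theorem exists_mem_essBoundary (hΩ : NullMeasurableSet Ω volume)
    {x : EuclideanSpace ℝ (Fin d)} {R : ℝ} (h : volume (Ω ∩ Metric.ball x R) ≠ 0)
    (h' : volume (Ωᶜ ∩ Metric.ball x R) ≠ 0) :
    ∃ y ∈ Metric.ball x R, y ∈ essBoundary Ω := by
  let B := {p : EuclideanSpace ℝ (Fin d) × ℝ // 0 < p.2 ∧
    volume.real (Ω ∩ Metric.ball p.1 p.2) = volume.real (Metric.ball p.1 p.2) / 2}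
  have hBpos : ∀ p : B, 0 < volume.real (Metric.ball p.1.1 p.1.2) := fun p =>
    ENNReal.toReal_pos (Metric.measure_ball_pos volume _ p.2.1).ne' measure_ball_lt_top.ne
  have hBcompl : ∀ p : B, volume.real (Ωᶜ ∩ Metric.ball p.1.1 p.1.2)
      = volume.real (Metric.ball p.1.1 p.1.2) / 2 := fun p => by
    have := measureReal_inter_ball_add_compl hΩ p.1.1 p.1.2
    linarith [p.2.2]
  have hne : ∀ {s : Set (EuclideanSpace ℝ (Fin d))}, 0 < volume.real s → volume s ≠ 0 := by
    intro s hs hs0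
    simp [measureReal_def, hs0] at hs
  have hstep : ∀ p : B, ∃ q : B, q.1.2 ≤ p.1.2 / 2 ∧
      Metric.closedBall q.1.1 q.1.2 ⊆ Metric.closedBall p.1.1 p.1.2 := fun p => by
    obtain ⟨y, r, hr, hrp, hsub, hy⟩ := exists_half_filled_ball hΩ (x := p.1.1) (R := p.1.2)
      (hne (by rw [p.2.2]; exact half_pos (hBpos p)))
      (hne (by rw [hBcompl p]; exact half_pos (hBpos p))) (half_pos p.2.1)
    exact ⟨⟨(y, r), hr, hy⟩, hrp, hsub.trans Metric.ball_subset_closedBall⟩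
  choose next hnext hnext' using hstep
  obtain ⟨y₀, r₀, hr₀, -, hsub₀, hy₀⟩ := exists_half_filled_ball hΩ h h' one_pos
  let b : ℕ → B := fun n => next^[n] ⟨(y₀, r₀), hr₀, hy₀⟩
  have hb : ∀ n, b (n + 1) = next (b n) := fun n => Function.iterate_succ_apply' _ _ _
  have hrad : ∀ n, (b n).1.2 ≤ r₀ * (1 / 2) ^ n := by
    intro n
    induction n with
    | zero => simp [b]
    | succ n ih =>
      rw [hb, pow_succ]
      linarith [hnext (b n)]
  obtain ⟨y, hy⟩ := IsCompact.nonempty_iInter_of_sequence_nonempty_isCompact_isClosed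
    (fun n => Metric.closedBall (b n).1.1 (b n).1.2)
    (fun n => by simp only [hb]; exact hnext' _)
    (fun n => Metric.nonempty_closedBall.2 (b n).2.1.le)
    (isCompact_closedBall _ _) (fun n => Metric.isClosed_closedBall)
  rw [mem_iInter] at hy
  have hlim : Tendsto (fun n : ℕ => r₀ * (1 / 2 : ℝ) ^ n) atTop (𝓝 0) := by
    simpa using (tendsto_pow_atTop_nhds_zero_of_lt_one (r := (1 / 2 : ℝ)) (by norm_num)
      (by norm_num)).const_mul r₀
  have hhalf : ∀ {s : Set (EuclideanSpace ℝ (Fin d))} (n : ℕ),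
      volume.real (s ∩ Metric.ball (b n).1.1 (b n).1.2)
        = volume.real (Metric.ball (b n).1.1 (b n).1.2) / 2 →
      volume (Metric.ball (b n).1.1 (b n).1.2) / 2
        ≤ volume (s ∩ Metric.ball (b n).1.1 (b n).1.2) := by
    intro s n hs
    rw [← ENNReal.toReal_le_toReal, ENNReal.toReal_div, ENNReal.toReal_ofNat]
    · exact hs.ge
    · exact ENNReal.div_ne_top measure_ball_lt_top.ne two_ne_zero
    · exact (measure_mono inter_subset_right |>.trans_lt measure_ball_lt_top).ne
  refine ⟨y, hsub₀ (hy 0), upperDensity_pos fun ε hε => ?_, upperDensity_pos fun ε hε => ?_⟩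
  · obtain ⟨n, hn⟩ := (hlim.eventually (gt_mem_nhds hε)).exists
    exact ⟨_, (b n).2.1, (hrad n).trans_lt hn, _, hy n, hhalf n (b n).2.2⟩
  · obtain ⟨n, hn⟩ := (hlim.eventually (gt_mem_nhds hε)).exists
    exact ⟨_, (b n).2.1, (hrad n).trans_lt hn, _, hy n, hhalf n (hBcompl _)⟩

/-- Away from the closure of its essential boundary, `Ω` is locally null or locally conull. -/
theorem compl_closure_essBoundary_subset (hΩ : NullMeasurableSet Ω volume) :
    (closure (essBoundary Ω))ᶜ ⊆ essExterior Ω ∪ essExterior Ωᶜ := by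
  intro x hx
  obtain ⟨r, hr, hsub⟩ := Metric.isOpen_iff.1 isClosed_closure.isOpen_compl x hx
  by_contra hcon
  rw [mem_union, not_or] at hcon
  obtain ⟨y, hy, hy'⟩ := exists_mem_essBoundary hΩ (fun h => hcon.1 ⟨r, hr, h⟩)
    (fun h => hcon.2 ⟨r, hr, h⟩)
  exact hsub hy (subset_closure hy')

/-- A connected set avoiding the closure of the essential boundary that has one exterior point
consists of exterior points. -/
theorem IsPreconnected.subset_essExterior (hΩ : NullMeasurableSet Ω volume)
    {S : Set (EuclideanSpace ℝ (Fin d))} (hS : IsPreconnected S)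
    (hSK : Disjoint S (closure (essBoundary Ω))) (hne : (S ∩ essExterior Ω).Nonempty) :
    S ⊆ essExterior Ω :=
  hS.subset_left_of_subset_union (isOpen_essExterior _) (isOpen_essExterior _)
    (disjoint_essExterior_compl Ω)
    (hSK.subset_compl_right.trans (compl_closure_essBoundary_subset hΩ)) hne

end LocalStructure

/-! ### Lines orthogonal to a hyperplane -/

section Lines

variable {d : ℕ} {ν : EuclideanSpace ℝ (Fin d)}

/-- The orthogonal projection onto `hyperplane ν c`, for a unit vector `ν`. -/
noncomputable def hyperplaneProj (hν : ‖ν‖ = 1) (c : ℝ) (x : EuclideanSpace ℝ (Fin d)) :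
    hyperplane ν c :=
  ⟨x - (inner ℝ ν x - c) • ν, by
    simp [hyperplane, inner_sub_right, inner_smul_right, hν]⟩

theorem hyperplaneProj_add_smul_eq (hν : ‖ν‖ = 1) (c : ℝ) (x : EuclideanSpace ℝ (Fin d)) :
    (hyperplaneProj hν c x : EuclideanSpace ℝ (Fin d)) + (inner ℝ ν x - c) • ν = x :=
  sub_add_cancel _ _

theorem inner_add_smul_sub (hν : ‖ν‖ = 1) (c : ℝ) (x : EuclideanSpace ℝ (Fin d)) (t : ℝ) :
    inner ℝ ν (x + t • ν) - c = inner ℝ ν x - c + t := by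
  rw [inner_add_right, inner_smul_right, real_inner_self_eq_norm_sq, hν]
  ring

theorem inner_hyperplane_add_smul_sub (hν : ‖ν‖ = 1) {c : ℝ} (z : hyperplane ν c) (t : ℝ) :
    inner ℝ ν ((z : EuclideanSpace ℝ (Fin d)) + t • ν) - c = t := by
  rw [inner_add_smul_sub hν, show inner ℝ ν (z : EuclideanSpace ℝ (Fin d)) = c from z.2]
  ring

theorem hyperplaneProj_add_smul (hν : ‖ν‖ = 1) (c : ℝ) (x : EuclideanSpace ℝ (Fin d)) (t : ℝ) :
    hyperplaneProj hν c (x + t • ν) = hyperplaneProj hν c x := by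
  apply Subtype.ext
  simp only [hyperplaneProj, inner_add_smul_sub hν]
  module

theorem hyperplaneProj_coe (hν : ‖ν‖ = 1) {c : ℝ} (z : hyperplane ν c) :
    hyperplaneProj hν c z = z := by
  apply Subtype.ext
  simp [hyperplaneProj, show inner ℝ ν (z : EuclideanSpace ℝ (Fin d)) = c from z.2]

theorem continuous_hyperplaneProj (hν : ‖ν‖ = 1) (c : ℝ) : Continuous (hyperplaneProj hν c) := by
  unfold hyperplaneProj
  fun_prop

theorem lowerHalfspace_eq (hν : ‖ν‖ = 1) (c : ℝ) :
    lowerHalfspace ν c = {x | inner ℝ ν x - c ≤ 0} := by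
  ext x
  constructor
  · rintro ⟨z, hz, t, ht, rfl⟩
    simpa only [mem_ofPred_eq, inner_hyperplane_add_smul_sub hν ⟨z, hz⟩] using ht
  · intro hx
    exact ⟨_, (hyperplaneProj hν c x).2, _, hx, (hyperplaneProj_add_smul_eq hν c x).symm⟩

/-- A set meeting each line in direction `ν` at most once has infinitely many disjoint translates
of equal measure in a bounded region. -/
theorem measure_eq_zero_of_meets_lines_once (hν : ‖ν‖ = 1)
    {s : Set (EuclideanSpace ℝ (Fin d))} (hs : MeasurableSet s)
    (h : ∀ x ∈ s, ∀ t : ℝ, x + t • ν ∈ s → t = 0) : volume s = 0 := by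
  refine Measure.addHaar_eq_zero_of_disjoint_translates volume
    (fun n : ℕ => (1 / ((n : ℝ) + 1)) • ν) ?_ ?_ hs
  · refine (Metric.isBounded_closedBall (x := (0 : EuclideanSpace ℝ (Fin d)))
      (r := 1)).subset ?_
    rintro _ ⟨n, rfl⟩
    have h1 : (1 : ℝ) / ((n : ℝ) + 1) ≤ 1 := by
      rw [div_le_one (by positivity)]
      linarith [n.cast_nonneg (α := ℝ)]
    rw [mem_closedBall_zero_iff, norm_smul, hν, mul_one, Real.norm_of_nonneg (by positivity)]
    exact h1
  · intro m n hmn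
    simp only [Function.onFun, Set.disjoint_left, singleton_add, mem_image]
    rintro _ ⟨x, hx, rfl⟩ ⟨y, hy, hxy⟩
    have hy' : y = x + (1 / ((m : ℝ) + 1) - 1 / ((n : ℝ) + 1)) • ν := by
      rw [sub_smul, ← add_sub_assoc, add_comm x, ← hxy]
      abel
    have h0 := h x hx _ (hy' ▸ hy)
    refine hmn ?_
    rw [sub_eq_zero, div_eq_div_iff (by positivity) (by positivity)] at h0
    have : (m : ℝ) = n := by linarith
    exact_mod_cast this

theorem measure_hyperplane (hν : ‖ν‖ = 1) (c : ℝ) : volume (hyperplane ν c) = 0 := by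
  refine measure_eq_zero_of_meets_lines_once hν ?_ fun x hx t ht => ?_
  · exact (isClosed_eq (by fun_prop) continuous_const).measurableSet
  · have h := inner_hyperplane_add_smul_sub hν ⟨x, hx⟩ t
    rw [show inner ℝ ν (x + t • ν) = c from ht] at h
    linarith

/-- If `Ω` agrees almost everywhere with the set between the graphs of `-φ` and `φ`, it is Steiner
symmetric: by Fubini, almost every line meets `Ω` in a set of length `2 φ`. -/
theorem steinerSymmetric_of_ae_eq (hν : ‖ν‖ = 1) {c : ℝ} {Ω : Set (EuclideanSpace ℝ (Fin d))}
    (φ : hyperplane ν c → ℝ)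
    (h : Ω =ᵐ[volume] ({x | |inner ℝ ν x - c| < φ (hyperplaneProj hν c x)} :
      Set (EuclideanSpace ℝ (Fin d)))) :
    SteinerSymmetric ν c Ω := by
  set S : Set (EuclideanSpace ℝ (Fin d)) :=
    {x | |inner ℝ ν x - c| < φ (hyperplaneProj hν c x)} with hS
  obtain ⟨A, hA, hAmeas, hAS⟩ := (Filter.eventuallyEq_set.1 h).exists_measurable_mem
  have hlines : ∀ᵐ x ∂(volume : Measure (EuclideanSpace ℝ (Fin d))),
      ∀ᵐ t ∂(volume : Measure ℝ), x + LinearMap.toSpanSingleton ℝ _ ν t ∈ A :=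
    (ae_ae_add_linearMap_mem_iff _ _ _ hAmeas).2 hA
  have hmem : ∀ᵐ x ∂(volume : Measure (EuclideanSpace ℝ (Fin d))), x ∈ A := hA
  refine Filter.eventuallyEq_set.2 ?_
  filter_upwards [hlines, hmem] with x hx hxA
  set z := hyperplaneProj hν c x with hz
  have hlength : Measure.hausdorffMeasure 1 (Ω ∩ normalLine ν z) / 2
      = ENNReal.ofReal (φ z) := by
    have hiso : Isometry fun t : ℝ => x + t • ν := by
      refine Isometry.of_dist_eq fun s t => ?_
      rw [dist_add_left, dist_eq_norm, ← sub_smul, norm_smul, hν, mul_one, Real.dist_eq,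
        Real.norm_eq_abs]
    -- The line is parametrized from `x` rather than from `z`, as Fubini is stated at `x`; this shifts
    -- the section by the height of `x`.
    have himage : Ω ∩ normalLine ν z = (fun t : ℝ => x + t • ν) '' {t | x + t • ν ∈ Ω} := by
      ext y
      constructor
      · rintro ⟨hy, t, rfl⟩
        have heq : x + (t - (inner ℝ ν x - c)) • ν = z + t • ν := by
          nth_rewrite 1 [← hyperplaneProj_add_smul_eq hν c x]
          module
        exact ⟨t - (inner ℝ ν x - c), by rwa [mem_ofPred_eq, heq], heq⟩
      · rintro ⟨t, ht, rfl⟩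
        refine ⟨ht, (inner ℝ ν x - c) + t, ?_⟩
        nth_rewrite 1 [← hyperplaneProj_add_smul_eq hν c x]
        module
    have hsection : ({t | x + t • ν ∈ Ω} : Set ℝ) =ᵐ[volume]
        Ioo (-φ z - (inner ℝ ν x - c)) (φ z - (inner ℝ ν x - c)) := by
      refine Filter.eventuallyEq_set.2 ?_
      filter_upwards [hx] with t ht
      have h1 : x + t • ν ∈ Ω ↔ x + t • ν ∈ S := hAS _ ht
      rw [h1, hS, mem_ofPred_eq, hyperplaneProj_add_smul, inner_add_smul_sub hν,
        abs_lt, mem_Ioo]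
      constructor <;> rintro ⟨h2, h3⟩ <;> constructor <;> linarith
    rw [himage, hiso.hausdorffMeasure_image (Or.inl zero_le_one), hausdorffMeasure_real,
      measure_congr hsection, Real.volume_Ioo,
      show φ z - (inner ℝ ν x - c) - (-φ z - (inner ℝ ν x - c)) = φ z * 2 by ring,
      ENNReal.ofReal_mul' zero_le_two, ENNReal.ofReal_ofNat,
      ENNReal.mul_div_cancel_right two_ne_zero ENNReal.ofNat_ne_top]
  have h1 : x ∈ Ω ↔ x ∈ S := hAS _ hxA
  rw [h1]
  constructor
  · intro hxS
    refine ⟨z, z.2, _, (hyperplaneProj_add_smul_eq hν c x).symm, ?_⟩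
    rw [hlength]
    exact (ENNReal.ofReal_lt_ofReal_iff_of_nonneg (abs_nonneg _)).2 hxS
  · rintro ⟨z', hz', t, hxt, ht⟩
    have hzz' : z = ⟨z', hz'⟩ := by
      rw [hz, hxt, hyperplaneProj_add_smul]
      exact hyperplaneProj_coe hν ⟨z', hz'⟩
    have htx : inner ℝ ν x - c = t := by
      rw [hxt]
      exact inner_hyperplane_add_smul_sub hν ⟨z', hz'⟩ t
    rw [show z' = z by rw [hzz'], hlength,
      ENNReal.ofReal_lt_ofReal_iff_of_nonneg (abs_nonneg _)] at ht
    rwa [hS, mem_ofPred_eq, htx]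

theorem reflectAbout_image_ae_eq {c : ℝ} {s t : Set (EuclideanSpace ℝ (Fin d))}
    (h : s =ᵐ[volume] t) : reflectAbout ν c '' s =ᵐ[volume] reflectAbout ν c '' t := by
  have hnull : ∀ u : Set (EuclideanSpace ℝ (Fin d)), volume u = 0 →
      volume (reflectAbout ν c '' u) = 0 := fun u hu => by
    refine addHaar_image_eq_zero_of_differentiableOn_of_addHaar_eq_zero volume ?_ hu
    have hinner : Differentiable ℝ fun x : EuclideanSpace ℝ (Fin d) => inner ℝ ν x :=
      (innerSL ℝ ν).differentiable
    unfold reflectAbout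
    exact Differentiable.differentiableOn (by fun_prop)
  have hsub : ∀ u v : Set (EuclideanSpace ℝ (Fin d)),
      reflectAbout ν c '' u \ reflectAbout ν c '' v ⊆ reflectAbout ν c '' (u \ v) := by
    rintro u v _ ⟨⟨x, hx, rfl⟩, hxv⟩
    exact ⟨x, ⟨hx, fun hx' => hxv ⟨x, hx', rfl⟩⟩, rfl⟩
  rw [ae_eq_set] at h ⊢
  exact ⟨measure_mono_null (hsub _ _) (hnull _ h.1), measure_mono_null (hsub _ _) (hnull _ h.2)⟩

end Lines

/-! ### The height of the essential boundary -/

section BoundaryHeight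

variable {d : ℕ} {ν : EuclideanSpace ℝ (Fin d)} {c : ℝ} {ω : Set (EuclideanSpace ℝ (Fin d))}

theorem boundaryHeight_nonpos (z : hyperplane ν c) : boundaryHeight ν c ω z ≤ 0 := by
  unfold boundaryHeight
  split_ifs with h
  · exact h.choose_spec.1.le
  · exact le_rfl

theorem mem_closure_essBoundary_of_boundaryHeight_neg {z : hyperplane ν c}
    (h : boundaryHeight ν c ω z < 0) :
    (z : EuclideanSpace ℝ (Fin d)) + boundaryHeight ν c ω z • ν ∈ closure (essBoundary ω) := by
  unfold boundaryHeight at h ⊢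
  split_ifs at h ⊢ with h'
  · exact h'.choose_spec.2
  · exact absurd h (lt_irrefl 0)

/-- A connected part of the open half-line below `z` that avoids the height `g z` contains no point
of the closure of the essential boundary, so being exterior propagates along it. -/
theorem add_smul_mem_essExterior_of_isPreconnected (hν : ‖ν‖ = 1)
    (hmeas : NullMeasurableSet ω volume) {z : hyperplane ν c}
    (hz : (closure (essBoundary ω) ∩ lowerRay ν z).Subsingleton) {S : Set ℝ}
    (hS : IsPreconnected S) (hneg : ∀ t ∈ S, t < 0) (hg : boundaryHeight ν c ω z ∉ S)
    {s : ℝ} (hs : s ∈ S) (hsext : (z : EuclideanSpace ℝ (Fin d)) + s • ν ∈ essExterior ω)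
    {t : ℝ} (ht : t ∈ S) : (z : EuclideanSpace ℝ (Fin d)) + t • ν ∈ essExterior ω := by
  have hcont : Continuous fun t : ℝ => (z : EuclideanSpace ℝ (Fin d)) + t • ν := by fun_prop
  refine (hS.image _ hcont.continuousOn).subset_essExterior hmeas ?_
    ⟨_, mem_image_of_mem _ hs, hsext⟩ (mem_image_of_mem _ ht)
  rw [Set.disjoint_left]
  rintro _ ⟨u, hu, rfl⟩ huK
  exact hg (boundaryHeight_eq hν hz (hneg u hu) huK ▸ hu)

/-- Far down the half-line the points are exterior because `ω` is bounded. -/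
theorem mem_essExterior_of_lt_boundaryHeight (hν : ‖ν‖ = 1)
    (hmeas : NullMeasurableSet ω volume) (hbdd : Bornology.IsBounded ω) {z : hyperplane ν c}
    (hz : (closure (essBoundary ω) ∩ lowerRay ν z).Subsingleton) {t : ℝ}
    (ht : t < boundaryHeight ν c ω z) :
    (z : EuclideanSpace ℝ (Fin d)) + t • ν ∈ essExterior ω := by
  obtain ⟨R, hR⟩ := hbdd.subset_closedBall 0
  set s := min t (-(|R| + ‖(z : EuclideanSpace ℝ (Fin d))‖ + 1))
  have hs : (z : EuclideanSpace ℝ (Fin d)) + s • ν ∈ essExterior ω := by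
    refine mem_essExterior_of_isOpen
      (U := (Metric.closedBall 0 R)ᶜ) Metric.isClosed_closedBall.isOpen_compl ?_ ?_
    · rw [← sdiff_eq, sdiff_eq_empty.2 hR, measure_empty]
    · rw [mem_compl_iff, mem_closedBall_zero_iff, not_le]
      have h1 : ‖s • ν‖ = |s| := by rw [norm_smul, hν, mul_one, Real.norm_eq_abs]
      have h2 := norm_sub_norm_le (s • ν) (-(z : EuclideanSpace ℝ (Fin d)))
      rw [sub_neg_eq_add, norm_neg, h1, add_comm (s • ν)] at h2
      have h3 : s ≤ -(|R| + ‖(z : EuclideanSpace ℝ (Fin d))‖ + 1) := min_le_right _ _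
      linarith [neg_le_abs s, le_abs_self R]
  exact add_smul_mem_essExterior_of_isPreconnected hν hmeas hz isPreconnected_Iio
    (fun u hu => lt_of_lt_of_le hu (boundaryHeight_nonpos z)) self_notMem_Iio
    ((min_le_left _ _).trans_lt ht : s ∈ Iio _) hs ht

theorem eq_boundaryHeight_hyperplaneProj (hν : ‖ν‖ = 1)
    (hsing : ∀ z ∈ hyperplane ν c, (closure (essBoundary ω) ∩ lowerRay ν z).Subsingleton)
    {x : EuclideanSpace ℝ (Fin d)} (hx : x ∈ closure (essBoundary ω))
    (hneg : inner ℝ ν x - c < 0) :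
    boundaryHeight ν c ω (hyperplaneProj hν c x) = inner ℝ ν x - c :=
  boundaryHeight_eq hν (hsing _ (hyperplaneProj hν c x).2) hneg
    (by rwa [hyperplaneProj_add_smul_eq])

theorem measure_closure_essBoundary_inter_lower (hν : ‖ν‖ = 1)
    (hsing : ∀ z ∈ hyperplane ν c, (closure (essBoundary ω) ∩ lowerRay ν z).Subsingleton) :
    volume (closure (essBoundary ω) ∩ {x | inner ℝ ν x - c < 0}) = 0 := by
  refine measure_eq_zero_of_meets_lines_once hν ?_ fun x hx t ht => ?_
  · exact isClosed_closure.measurableSet.inter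
      (isOpen_lt (by fun_prop) continuous_const).measurableSet
  · have h1 := eq_boundaryHeight_hyperplaneProj hν hsing hx.1 hx.2
    have h2 := eq_boundaryHeight_hyperplaneProj hν hsing ht.1 ht.2
    rw [hyperplaneProj_add_smul, inner_add_smul_sub hν] at h2
    linarith

/-- If some point between `g z` and `0` were exterior, then both sides of the point at height `g z`
would be. Nearby lines also start and end in the exterior and meet the closure of the essential
boundary at most once, so all their other points are exterior. Hence `ω` would be null near a point
of the closure of its essential boundary. -/
theorem mem_essExterior_compl_of_boundaryHeight_lt (hν : ‖ν‖ = 1)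
    (hmeas : NullMeasurableSet ω volume)
    (hsing : ∀ z ∈ hyperplane ν c, (closure (essBoundary ω) ∩ lowerRay ν z).Subsingleton)
    (hbdd : Bornology.IsBounded ω) (z : hyperplane ν c) {t : ℝ}
    (ht : boundaryHeight ν c ω z < t) (ht0 : t < 0) :
    (z : EuclideanSpace ℝ (Fin d)) + t • ν ∈ essExterior ωᶜ := by
  have hz := hsing z z.2
  set g := boundaryHeight ν c ω z with hg
  have hg0 : g < 0 := ht.trans ht0
  have htK : (z : EuclideanSpace ℝ (Fin d)) + t • ν ∈ (closure (essBoundary ω))ᶜ :=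
    fun h => ht.ne (boundaryHeight_eq hν hz ht0 h)
  refine (compl_closure_essBoundary_subset hmeas htK).resolve_left fun hext => ?_
  have habove : ∀ s ∈ Ioo g 0, (z : EuclideanSpace ℝ (Fin d)) + s • ν ∈ essExterior ω :=
    fun s hs => add_smul_mem_essExterior_of_isPreconnected hν hmeas hz isPreconnected_Ioo
      (fun u hu => hu.2) (fun h => lt_irrefl _ h.1) ⟨ht, ht0⟩ hext hs
  -- `ε` is small enough for the heights `g ± ε` to be negative.
  set ε := -g / 2 with hε
  have hε0 : 0 < ε := by linarith
  set V : Set (EuclideanSpace ℝ (Fin d)) :=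
    (fun y => y + (-ε) • ν) ⁻¹' essExterior ω ∩ (fun y => y + ε • ν) ⁻¹' essExterior ω ∩
      {y | inner ℝ ν y - c + ε < 0} with hV
  have hVopen : IsOpen V :=
    (((isOpen_essExterior ω).preimage (by fun_prop)).inter
      ((isOpen_essExterior ω).preimage (by fun_prop))).inter
      (isOpen_lt (by fun_prop) continuous_const)
  have hVK : ∀ y ∈ V, y ∉ closure (essBoundary ω) → y ∈ essExterior ω := by
    rintro y ⟨⟨hy1, hy2⟩, hy3⟩ hyK
    have hy3 : inner ℝ ν y - c + ε < 0 := hy3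
    have hzy := hsing _ (hyperplaneProj hν c y).2
    have hproj := hyperplaneProj_add_smul_eq hν c y
    set s := inner ℝ ν y - c with hs
    set w := hyperplaneProj hν c y with hw
    have hws : ∀ u : ℝ, y + u • ν = w + (s + u) • ν := fun u => by
      rw [add_smul, ← add_assoc, hproj]
    rw [mem_preimage, hws] at hy1 hy2
    have hgs : boundaryHeight ν c ω w ≠ s := fun h => hyK <| by
      have h1 : boundaryHeight ν c ω w < 0 := by linarith
      have := mem_closure_essBoundary_of_boundaryHeight_neg h1
      rwa [h, hproj] at this
    rw [← hproj]
    rcases lt_or_gt_of_ne hgs with h | h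
    · exact add_smul_mem_essExterior_of_isPreconnected hν hmeas hzy
        (isPreconnected_Icc (a := s) (b := s + ε)) (fun u hu => hu.2.trans_lt hy3)
        (fun h' => h.not_ge h'.1) (right_mem_Icc.2 (by linarith)) hy2 (left_mem_Icc.2 (by linarith))
    · exact add_smul_mem_essExterior_of_isPreconnected hν hmeas hzy
        (isPreconnected_Icc (a := s + -ε) (b := s)) (fun u hu => by linarith [hu.2])
        (fun h' => h.not_ge h'.2) (left_mem_Icc.2 (by linarith)) hy1 (right_mem_Icc.2 (by linarith))
  have hnull : volume (ω ∩ V) = 0 := by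
    refine measure_mono_null ?_ (measure_union_null (measure_inter_essExterior ω)
      (measure_closure_essBoundary_inter_lower hν hsing))
    rintro y ⟨hyω, hyV⟩
    by_cases hyK : y ∈ closure (essBoundary ω)
    · have h3 : inner ℝ ν y - c + ε < 0 := hyV.2
      exact Or.inr ⟨hyK, show inner ℝ ν y - c < 0 by linarith⟩
    · exact Or.inl ⟨hyω, hVK y hyV hyK⟩
  refine Set.disjoint_left.1 (disjoint_essExterior_closure_essBoundary ω)
    (mem_essExterior_of_isOpen hVopen hnull ?_)
    (mem_closure_essBoundary_of_boundaryHeight_neg hg0)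
  refine ⟨⟨?_, ?_⟩, ?_⟩
  · rw [mem_preimage, add_assoc, ← add_smul]
    exact mem_essExterior_of_lt_boundaryHeight hν hmeas hbdd hz (by linarith)
  · rw [mem_preimage, add_assoc, ← add_smul]
    exact habove _ ⟨by linarith, by linarith⟩
  · rw [mem_ofPred_eq, inner_hyperplane_add_smul_sub hν]
    linarith

/-- Both semicontinuities hold because the exterior and the interior of `ω` are open. -/
theorem continuous_boundaryHeight (hν : ‖ν‖ = 1)
    (hmeas : NullMeasurableSet ω volume) (hbdd : Bornology.IsBounded ω)
    (hsing : ∀ z ∈ hyperplane ν c, (closure (essBoundary ω) ∩ lowerRay ν z).Subsingleton) :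
    Continuous (boundaryHeight ν c ω) := by
  have hext : ∀ (z : hyperplane ν c) {t : ℝ}, t < boundaryHeight ν c ω z →
      (z : EuclideanSpace ℝ (Fin d)) + t • ν ∈ essExterior ω :=
    fun z t ht => mem_essExterior_of_lt_boundaryHeight hν hmeas hbdd (hsing z z.2) ht
  have hint : ∀ (z : hyperplane ν c) {t : ℝ}, boundaryHeight ν c ω z < t → t < 0 →
      (z : EuclideanSpace ℝ (Fin d)) + t • ν ∈ essExterior ωᶜ :=
    fun z t ht ht0 => mem_essExterior_compl_of_boundaryHeight_lt hν hmeas hsing hbdd z ht ht0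
  have hdisj := Set.disjoint_left.1 (disjoint_essExterior_compl ω)
  have hshift : ∀ t : ℝ, Continuous fun z : hyperplane ν c =>
      (z : EuclideanSpace ℝ (Fin d)) + t • ν := fun t => by fun_prop
  rw [continuous_iff_continuousAt]
  intro z
  refine tendsto_order.2 ⟨fun a ha => ?_, fun b hb => ?_⟩
  · obtain ⟨a', ha', ha'z⟩ := exists_between ha
    filter_upwards [((isOpen_essExterior ω).preimage (hshift a')).mem_nhds (hext z ha'z)] with y hy
    refine ha'.trans_le (not_lt.1 fun h => hdisj hy (hint y h ?_))
    exact ha'z.trans_le (boundaryHeight_nonpos z)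
  · rcases lt_or_ge 0 b with hb0 | hb0
    · exact Eventually.of_forall fun y => (boundaryHeight_nonpos y).trans_lt hb0
    · obtain ⟨b', hb'z, hb'⟩ := exists_between hb
      filter_upwards [((isOpen_essExterior ωᶜ).preimage (hshift b')).mem_nhds
        (hint z hb'z (hb'.trans_le hb0))] with y hy
      exact (not_lt.1 fun h => hdisj (hext y h) hy).trans_lt hb'

theorem ae_eq_subgraph (hν : ‖ν‖ = 1)
    (hmeas : NullMeasurableSet ω volume) (hbdd : Bornology.IsBounded ω)
    (hsub : ω ⊆ lowerHalfspace ν c)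
    (hsing : ∀ z ∈ hyperplane ν c, (closure (essBoundary ω) ∩ lowerRay ν z).Subsingleton) :
    ω =ᵐ[volume] ({x | boundaryHeight ν c ω (hyperplaneProj hν c x) < inner ℝ ν x - c ∧
      inner ℝ ν x - c < 0} : Set (EuclideanSpace ℝ (Fin d))) := by
  rw [lowerHalfspace_eq hν] at hsub
  rw [ae_eq_set]
  constructor
  · refine measure_mono_null ?_ (measure_union_null (measure_union_null
      (measure_inter_essExterior ω) (measure_closure_essBoundary_inter_lower hν hsing))
      (measure_hyperplane hν c))
    rintro x ⟨hxω, hx⟩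
    have hx0 : inner ℝ ν x - c ≤ 0 := hsub hxω
    rcases hx0.lt_or_eq with hneg | h0
    · refine Or.inl ?_
      have hle : inner ℝ ν x - c ≤ boundaryHeight ν c ω (hyperplaneProj hν c x) :=
        not_lt.1 fun h => hx ⟨h, hneg⟩
      rcases hle.lt_or_eq with hlt | heq
      · have := mem_essExterior_of_lt_boundaryHeight hν hmeas hbdd
          (hsing _ (hyperplaneProj hν c x).2) hlt
        rw [hyperplaneProj_add_smul_eq] at this
        exact Or.inl ⟨hxω, this⟩
      · have := mem_closure_essBoundary_of_boundaryHeight_neg (heq ▸ hneg)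
        rw [← heq, hyperplaneProj_add_smul_eq] at this
        exact Or.inr ⟨this, hneg⟩
    · exact Or.inr (sub_eq_zero.1 h0)
  · refine measure_mono_null ?_ (measure_inter_essExterior ωᶜ)
    rintro x ⟨⟨hx, hx0⟩, hxω⟩
    have := mem_essExterior_compl_of_boundaryHeight_lt hν hmeas hsing hbdd _ hx hx0
    rw [hyperplaneProj_add_smul_eq] at this
    exact ⟨hxω, this⟩

theorem closure_essBoundary_subset_lowerHalfspace (hν : ‖ν‖ = 1)
    (hsub : ω ⊆ lowerHalfspace ν c) : closure (essBoundary ω) ⊆ {x | inner ℝ ν x - c ≤ 0} := by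
  rw [lowerHalfspace_eq hν] at hsub
  intro x hx
  by_contra hpos
  have hopen : IsOpen ({x | inner ℝ ν x - c ≤ 0}ᶜ : Set (EuclideanSpace ℝ (Fin d))) :=
    (isClosed_le (by fun_prop) continuous_const).isOpen_compl
  refine Set.disjoint_left.1 (disjoint_essExterior_closure_essBoundary ω)
    (mem_essExterior_of_isOpen hopen ?_ hpos) hx
  rw [← sdiff_eq, sdiff_eq_empty.2 hsub, measure_empty]

theorem measure_closure_essBoundary (hν : ‖ν‖ = 1) (hsub : ω ⊆ lowerHalfspace ν c)
    (hsing : ∀ z ∈ hyperplane ν c, (closure (essBoundary ω) ∩ lowerRay ν z).Subsingleton) :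
    volume (closure (essBoundary ω)) = 0 := by
  refine measure_mono_null ?_ (measure_union_null
    (measure_closure_essBoundary_inter_lower hν hsing) (measure_hyperplane hν c))
  intro x hx
  have hx0 : inner ℝ ν x - c ≤ 0 := closure_essBoundary_subset_lowerHalfspace hν hsub hx
  rcases hx0.lt_or_eq with h | h
  · exact Or.inl ⟨hx, h⟩
  · exact Or.inr (sub_eq_zero.1 h)

/-- The subgraph of `g` together with its reflection is, up to the hyperplane itself,
the set between the graphs of `g` and `-g`. -/
theorem union_reflectAbout_ae_eq (hν : ‖ν‖ = 1) {g : hyperplane ν c → ℝ}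
    (h : ω =ᵐ[volume] ({x | g (hyperplaneProj hν c x) < inner ℝ ν x - c ∧
      inner ℝ ν x - c < 0} : Set (EuclideanSpace ℝ (Fin d)))) :
    (ω ∪ reflectAbout ν c '' ω : Set (EuclideanSpace ℝ (Fin d))) =ᵐ[volume]
      ({x | |inner ℝ ν x - c| < -g (hyperplaneProj hν c x)} :
        Set (EuclideanSpace ℝ (Fin d))) := by
  refine (ae_eq_set_union h (reflectAbout_image_ae_eq h)).trans (Filter.eventuallyEq_set.2 ?_)
  filter_upwards [measure_eq_zero_iff_ae_notMem.1 (measure_hyperplane hν c)] with x hxH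
  have hx0 : inner ℝ ν x - c ≠ 0 := sub_ne_zero.2 hxH
  have hrefl : ∀ y : EuclideanSpace ℝ (Fin d), reflectAbout ν c y
      = y + (-(2 * (inner ℝ ν y - c))) • ν := fun y => by rw [reflectAbout]; module
  constructor
  · rintro (⟨h1, h2⟩ | ⟨y, ⟨h1, h2⟩, rfl⟩)
    · rw [abs_of_neg h2]
      linarith
    · rw [hrefl, hyperplaneProj_add_smul, inner_add_smul_sub hν,
        abs_of_pos (by linarith)]
      linarith
  · intro hx
    rcases lt_or_gt_of_ne hx0 with hneg | hpos
    · rw [abs_of_neg hneg] at hx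
      exact Or.inl ⟨by linarith, hneg⟩
    · rw [abs_of_pos hpos] at hx
      refine Or.inr ⟨reflectAbout ν c x, ⟨?_, ?_⟩, ?_⟩
      · rw [hrefl, hyperplaneProj_add_smul, inner_add_smul_sub hν]
        linarith
      · rw [hrefl, inner_add_smul_sub hν]
        linarith
      · rw [hrefl (reflectAbout ν c x), hrefl x, inner_add_smul_sub hν]
        module

end BoundaryHeight

theorem propositionl {d : ℕ} (ν : EuclideanSpace ℝ (Fin d)) (hν : ‖ν‖ = 1) (c : ℝ)
    (ω : Set (EuclideanSpace ℝ (Fin d)))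
    (hmeas : NullMeasurableSet ω volume)
    (hbdd : Bornology.IsBounded ω)
    (hsub : ω ⊆ lowerHalfspace ν c)
    (hsing : ∀ z ∈ hyperplane ν c, (closure (essBoundary ω) ∩ lowerRay ν z).Subsingleton) :
    -- `ω` is the subgraph of `g`
    ω =ᵐ[volume] ({x | ∃ z : hyperplane ν c, ∃ t : ℝ,
      boundaryHeight ν c ω z < t ∧ t < 0 ∧ x = z + t • ν} : Set (EuclideanSpace ℝ (Fin d))) ∧
    -- (i)
    volume (closure (essBoundary ω)) = 0 ∧
    -- (ii)
    EssentiallyOpen ω ∧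
    -- (iii)
    SteinerSymmetric ν c (ω ∪ reflectAbout ν c '' ω) ∧
    -- (iv)
    Continuous (boundaryHeight ν c ω) := by
  have hae := ae_eq_subgraph hν hmeas hbdd hsub hsing
  have hcont := continuous_boundaryHeight hν hmeas hbdd hsing
  refine ⟨?_, measure_closure_essBoundary hν hsub hsing, ⟨_, ?_, hae⟩, ?_, hcont⟩
  · refine hae.trans (Filter.eventuallyEq_set.2 (Eventually.of_forall fun x => ?_))
    rw [iff_comm]
    constructor
    · rintro ⟨z, t, h1, h2, rfl⟩
      rw [mem_ofPred_eq, hyperplaneProj_add_smul, hyperplaneProj_coe,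
        inner_hyperplane_add_smul_sub hν]
      exact ⟨h1, h2⟩
    · rintro ⟨h1, h2⟩
      exact ⟨_, _, h1, h2, (hyperplaneProj_add_smul_eq hν c x).symm⟩
  · have hheight : Continuous fun x : EuclideanSpace ℝ (Fin d) => inner ℝ ν x - c := by fun_prop
    exact (isOpen_lt (hcont.comp (continuous_hyperplaneProj hν c)) hheight).inter
      (isOpen_lt hheight continuous_const)
  · exact steinerSymmetric_of_ae_eq hν (fun z => -boundaryHeight ν c ω z)
      (union_reflectAbout_ae_eq hν hae)
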